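/- Let $V$ be a finite set, $(V,E)$ a tree with edge weights $w:E\to(0,\infty)$, and $\mathcal S$ a family of subsets of $V$ that contains $\emptyset$, is closed under taking subsets, and contains every singleton and every edge $\{u,v\}\in E$. The forbidden sets are the inclusion-minimal subsets of $V$ not in $\mathcal S$; list them as $F_1,\dots,F_b$, and let $E=\{e_1,\dots,e_m\}$. Let $A=(a_{i,j})$ be the $b\times m$ matrix with $a_{i,j}=1$ if $e_j$ lies on the tree path between some two vertices of $F_i$, and $a_{i,j}=0$ otherwise. Suppose that for every $R\subseteq\{1,\dots,b\}$ there is a partition $R=R_1\sqcup R_2$ (parts may be empty) such that $$\sum_{i\in R_1}a_{i,j}-\sum_{i\in R_2}a_{i,j}\in\{-1,0,1\}\qquad (j=1,\dots,m).$$ Then $A$ is totally unimodular, and the linear program $$\text{minimize }\sum_{j=1}^m w(e_j)x_j\quad\text{subject to } A\mathbf x\ge\mathbf 1,\ \mathbf x\ge 0,\ \mathbf x\in\mathbb R^m$$ has an optimum solution with integer coordinates. Moreover, every optimum solution $\mathbf x$ of this linear program with integer coordinates has all $x_j\in\{0,1\}$ and is an optimum of the set-cover program obtained by requiring $x_j\in\{0,1\}$,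 and it solves the combinatorial data fusion problem on the tree, in each of its three formulations. That is, with $K=\{e_j: x_j=1\}$ and $E_1=E\setminus K$: 1. no component of $(V,E_1)$ contains a forbidden set, and $E_1$ has maximum total weight among all subsets of $E$ with this property; 2. every colouring $\chi:V\to\mathbb N$ for which $\chi(u)=\chi(v)$ exactly when $u,v$ lie in the same component of $(V,E_1)$ minimizes the total weight of the edges with differently coloured endpoints, among all colourings $V\to\mathbb N$ under which no forbidden set is monochromatic, and is itself such a colouring; 3. the vertex sets of the components of $(V,E_1)$ form a collection of pairwise disjoint members of $\mathcal S$ which maximizes, among all such collections, the sum over its members $U$ of the total weight of the edges of $E$ with both endpoints in $U$. -/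

import Mathlib

noncomputable section

open scoped Classical

/-- An independence system on `V`: a family of subsets that contains the empty set and is closed
under passing to subsets. -/
structure IndependenceSystem (V : Type*) where
  sets : Set (Set V)
  empty_mem : ∅ ∈ sets
  mem_of_subset : ∀ U ∈ sets, ∀ W ⊆ U, W ∈ sets

/-- The circuits of an independence system: the inclusion-minimal dependent sets. -/
def IndependenceSystem.circuits {V : Type*} (S : IndependenceSystem V) : Set (Set V) :=
  {F | Minimal (fun U => U ∉ S.sets) F}

/-- A combinatorial data fusion problem on a finite vertex set: a connected graph with positive edge
weights, and an independence system that contains all singletons and all edges of the graph. -/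
structure DataFusionProblem (V : Type*) [Fintype V] where
  graph : SimpleGraph V
  connected : graph.Connected
  weight : graph.edgeSet → ℝ
  weight_pos : ∀ e, 0 < weight e
  allowable : IndependenceSystem V
  singleton_mem : ∀ v : V, {v} ∈ allowable.sets
  edge_mem : ∀ u v : V, graph.Adj u v → {u, v} ∈ allowable.sets

/-- The Ghouila-Houri condition: every set of rows splits into two parts such that, in each column,
the sums of the entries over the two parts differ by at most one. -/
def GhouilaHouri {m n : Type*} (A : Matrix m n ℤ) : Prop :=
  ∀ R : Finset m, ∃ R₁ R₂ : Finset m, R₁ ∪ R₂ = R ∧ Disjoint R₁ R₂ ∧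
    ∀ j : n, ∑ i ∈ R₁, A i j - ∑ i ∈ R₂, A i j ∈ ({-1, 0, 1} : Set ℤ)

namespace DataFusionProblem

variable {V : Type*} [Fintype V] (P : DataFusionProblem V)

/-- The edges of the underlying graph, as a type. -/
abbrev Edge : Type _ := P.graph.edgeSet

/-- The forbidden sets are the circuits of the independence system. -/
def forbidden : Set (Set V) := P.allowable.circuits

/-! ### Subgraph formulation -/

/-- The spanning subgraph with edge set `E₁`. -/
def spanning (E₁ : Finset P.Edge) : SimpleGraph V :=
  SimpleGraph.fromEdgeSet ((fun e : P.Edge => (e : Sym2 V)) '' (E₁ : Set P.Edge))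

/-- No component of `(V, E₁)` contains a forbidden set. -/
def IsFeasibleSubgraph (E₁ : Finset P.Edge) : Prop :=
  ∀ F ∈ P.forbidden, ∀ C : (P.spanning E₁).ConnectedComponent, ¬ F ⊆ C.supp

/-- A feasible subgraph of maximum total weight. -/
def IsMaximumSubgraph (E₁ : Finset P.Edge) : Prop :=
  P.IsFeasibleSubgraph E₁ ∧
    ∀ E₂ : Finset P.Edge, P.IsFeasibleSubgraph E₂ → ∑ e ∈ E₂, P.weight e ≤ ∑ e ∈ E₁, P.weight e

/-! ### Coloring formulation -/

/-- A coloring of the forbidden hypergraph: no forbidden set is monochromatic. -/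
def IsHypergraphColoring (χ : V → ℕ) : Prop :=
  ∀ F ∈ P.forbidden, ∀ j : ℕ, ¬ F ⊆ χ ⁻¹' {j}

/-- Total weight of the edges whose endpoints have different colors. -/
def coloringCost (χ : V → ℕ) : ℝ :=
  ∑ e ∈ Finset.univ.filter fun e : P.Edge =>
    ∃ u ∈ (e : Sym2 V), ∃ v ∈ (e : Sym2 V), χ u ≠ χ v, P.weight e

/-- A hypergraph coloring of minimum cost. -/
def IsOptimumColoring (χ : V → ℕ) : Prop :=
  P.IsHypergraphColoring χ ∧
    ∀ ψ : V → ℕ, P.IsHypergraphColoring ψ → P.coloringCost χ ≤ P.coloringCost ψ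

/-! ### Matching formulation -/

/-- Total weight of the edges of the subgraph induced on `U`. -/
def inducedWeight (U : Set V) : ℝ :=
  ∑ e ∈ Finset.univ.filter fun e : P.Edge => ∀ v ∈ (e : Sym2 V), v ∈ U, P.weight e

/-- A matching of the allowable hypergraph: a collection of pairwise disjoint independent sets. -/
def IsMatching (M : Finset (Set V)) : Prop :=
  (∀ U ∈ M, U ∈ P.allowable.sets) ∧ (M : Set (Set V)).PairwiseDisjoint id

/-- A matching of maximum total weight. -/
def IsMaximumMatching (M : Finset (Set V)) : Prop :=
  P.IsMatching M ∧
    ∀ N : Finset (Set V), P.IsMatching N →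
      ∑ U ∈ N, P.inducedWeight U ≤ ∑ U ∈ M, P.inducedWeight U

/-- The vertex sets of the components of `(V, E₁)`. -/
def componentSets (E₁ : Finset P.Edge) : Finset (Set V) :=
  Finset.univ.image fun C : (P.spanning E₁).ConnectedComponent => C.supp

/-- Deleting the edge set `K` solves the data fusion problem: the remaining edges form a maximum
subgraph, giving distinct colors to distinct components of it is an optimum coloring, and the
vertex sets of its components form a maximum weight matching. -/
def IsOptimumDeletion (K : Finset P.Edge) : Prop :=
  P.IsMaximumSubgraph Kᶜ ∧
    (∀ χ : V → ℕ, (∀ u v : V, χ u = χ v ↔ (P.spanning Kᶜ).Reachable u v) →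
      P.IsOptimumColoring χ) ∧
    P.IsMaximumMatching (P.componentSets Kᶜ)

/-! ### Set cover formulation (used when the graph is a tree) -/

/-- The union, over all `u, v ∈ F`, of the edges on the paths from `u` to `v`. When the graph is a
tree, there is exactly one such path for each pair. -/
def pathEdges (F : Set V) : Set P.Edge :=
  {e | ∃ u ∈ F, ∃ v ∈ F, ∃ p : P.graph.Walk u v, p.IsPath ∧ (e : Sym2 V) ∈ p.edges}

/-- The constraint matrix: rows are the forbidden sets, columns are the edges. -/
def constraintMatrix : Matrix P.forbidden P.Edge ℤ :=
  Matrix.of fun F e => if e ∈ P.pathEdges (F : Set V) then 1 else 0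

/-- The linear objective function. -/
def cost (x : P.Edge → ℝ) : ℝ := ∑ e, P.weight e * x e

/-- The constraints `A x ≥ 1`. -/
def SatisfiesConstraints (x : P.Edge → ℝ) : Prop :=
  ∀ F : P.forbidden, 1 ≤ ∑ e, (P.constraintMatrix F e : ℝ) * x e

/-- Feasibility for the set cover program. -/
def IsSetCoverFeasible (x : P.Edge → ℝ) : Prop :=
  (∀ e, x e = 0 ∨ x e = 1) ∧ P.SatisfiesConstraints x

/-- An optimum of the set cover program. -/
def IsSetCoverOptimum (x : P.Edge → ℝ) : Prop :=
  P.IsSetCoverFeasible x ∧ ∀ y, P.IsSetCoverFeasible y → P.cost x ≤ P.cost y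

/-- Feasibility for the linear programming relaxation. -/
def IsLPFeasible (x : P.Edge → ℝ) : Prop :=
  (∀ e, 0 ≤ x e) ∧ P.SatisfiesConstraints x

/-- An optimum of the linear programming relaxation. -/
def IsLPOptimum (x : P.Edge → ℝ) : Prop :=
  P.IsLPFeasible x ∧ ∀ y, P.IsLPFeasible y → P.cost x ≤ P.cost y

end DataFusionProblem

end

/-! ### Ghouila-Houri's criterion -/

noncomputable section

open scoped Classical

/-! Total unimodularity goes by induction on the order of a square submatrix `B`. The first row `y`
of its adjugate has entries in {-1, 0, 1} and satisfies `y B = det B • e₀`. Splitting the rows where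
`y` is nonzero gives a signing `z ≡ y` mod 2. Away from column 0 the entries of `z B` are even and
at most 1 in absolute value, so `z B = t • e₀` with `|t| ≤ 1`; multiplying by the adjugate gives
`det B • z = t • y`, whence `|det B| ≤ 1`.

For the linear program, capping coordinates at 1 preserves feasibility and never raises the cost, so
it suffices to minimize over a compact polytope in the unit cube. Extreme points of that polytope
are integral (`integral_of_mem_extremePoints_coverPolytope`). Positive weights force every optimum
below 1, so integral optima are 0/1.

In a tree a component contains a forbidden set exactly when none of its path edges is deleted, so
0/1 solutions are the feasible deletions, and minimum cost means maximum kept weight. Colourings and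
matchings reduce to subgraphs through the edges that they do not cut. -/

theorem GhouilaHouri.exists_signing {m n : Type*} {A : Matrix m n ℤ} (hA : GhouilaHouri A)
    {ι : Type*} [Fintype ι] {f : ι → m} (hf : f.Injective) (s : Finset ι) :
    ∃ z : ι → ℤ, (∀ i ∈ s, z i = 1 ∨ z i = -1) ∧ (∀ i ∉ s, z i = 0) ∧
      ∀ j, ∑ i, z i * A (f i) j ∈ ({-1, 0, 1} : Set ℤ) := by
  obtain ⟨R₁, R₂, hR, hd, h⟩ := hA (s.image f)
  have hmem : ∀ i, i ∈ s ↔ f i ∈ R₁ ∨ f i ∈ R₂ := fun i => by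
    rw [← Finset.mem_union, hR, Finset.mem_image]
    exact ⟨fun hi => ⟨i, hi, rfl⟩, fun ⟨i', hi', e⟩ => hf e ▸ hi'⟩
  have hsum : ∀ R ⊆ s.image f, ∀ j,
      ∑ i, (if f i ∈ R then A (f i) j else 0) = ∑ i ∈ R, A i j := fun R hRs j => by
    rw [← Finset.sum_filter]
    refine Finset.sum_bij (fun i _ => f i) (by simp) (fun _ _ _ _ e => hf e) (fun i hi => ?_)
      (fun _ _ => rfl)
    obtain ⟨i', -, rfl⟩ := Finset.mem_image.1 (hRs hi)
    exact ⟨i', by simpa using hi, rfl⟩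
  refine ⟨fun i => (if f i ∈ R₁ then 1 else 0) - (if f i ∈ R₂ then 1 else 0), fun i hi => ?_,
    fun i hi => ?_, fun j => ?_⟩
  · rcases (hmem i).1 hi with h1 | h2
    · simp [h1, Finset.disjoint_left.1 hd h1]
    · simp [h2, Finset.disjoint_right.1 hd h2]
  · rw [hmem, not_or] at hi
    simp [hi.1, hi.2]
  · convert h j using 1
    rw [← hsum R₁ (hR ▸ Finset.subset_union_left) j, ← hsum R₂ (hR ▸ Finset.subset_union_right) j,
      ← Finset.sum_sub_distrib]
    refine Finset.sum_congr rfl fun i _ => ?_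
    simp only [sub_mul, ite_mul, one_mul, zero_mul]

theorem Int.mem_range_signType_cast {a : ℤ} :
    a ∈ Set.range (SignType.cast : SignType → ℤ) ↔ a = -1 ∨ a = 0 ∨ a = 1 := by
  constructor
  · rintro ⟨s, rfl⟩
    cases s <;> simp
  · rintro (rfl | rfl | rfl)
    exacts [⟨-1, rfl⟩, ⟨0, rfl⟩, ⟨1, rfl⟩]

/-- Ghouila-Houri's criterion for total unimodularity. -/
theorem GhouilaHouri.isTotallyUnimodular {m n : Type*} {A : Matrix m n ℤ} (hA : GhouilaHouri A) :
    A.IsTotallyUnimodular := by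
  intro k
  induction k with
  | zero => intro f g _ _; exact ⟨1, by simp⟩
  | succ k ih =>
    intro f g hf hg
    set B := A.submatrix f g with hB
    -- These entries are signed minors of order `k`, so the induction hypothesis bounds them.
    have hy : ∀ i, B.adjugate 0 i = -1 ∨ B.adjugate 0 i = 0 ∨ B.adjugate 0 i = 1 := fun i => by
      have h := ih (f ∘ i.succAbove) (g ∘ Fin.succAbove 0)
        (hf.comp Fin.succAbove_right_injective) (hg.comp Fin.succAbove_right_injective)
      rw [Int.mem_range_signType_cast] at h
      rw [Matrix.adjugate_fin_succ_eq_det_submatrix, hB, Matrix.submatrix_submatrix]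
      rcases neg_one_pow_eq_or ℤ ((i : ℕ) + ((0 : Fin (k + 1)) : ℕ)) with e | e <;>
        rw [e] <;> omega
    obtain ⟨z, hz1, hz0, hz⟩ := hA.exists_signing hf
      (Finset.univ.filter fun i => B.adjugate 0 i ≠ 0)
    simp only [Finset.mem_filter, Finset.mem_univ, true_and, not_not] at hz1 hz0
    have hyB : ∀ j, ∑ i, B.adjugate 0 i * B i j =
        B.det * (1 : Matrix (Fin (k + 1)) (Fin (k + 1)) ℤ) 0 j := fun j => by
      rw [← Matrix.mul_apply, Matrix.adjugate_mul, Matrix.smul_apply, smul_eq_mul]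
    -- Parity: `z` and the cofactor row agree mod 2, and the latter is orthogonal to column `j`.
    have hq : ∀ j, j ≠ 0 → ∑ i, z i * B i j = 0 := fun j hj => by
      have h2 : (2 : ℤ) ∣ ∑ i, z i * B i j - ∑ i, B.adjugate 0 i * B i j := by
        rw [← Finset.sum_sub_distrib]
        refine Finset.dvd_sum fun i _ => ?_
        rw [← sub_mul]
        refine Dvd.dvd.mul_right ?_ _
        by_cases h : B.adjugate 0 i = 0
        · simp [h, hz0 i h]
        · have := hz1 i h
          have := hy i
          omega
      rw [hyB, Matrix.one_apply_ne hj.symm, mul_zero, sub_zero] at h2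
      have h3 := hz (g j)
      simp only [Set.mem_insert_iff, Set.mem_singleton_iff] at h3
      change _ = -1 ∨ _ = 0 ∨ _ = 1 at h3
      change (2 : ℤ) ∣ ∑ i, z i * A (f i) (g j) at h2
      change ∑ i, z i * A (f i) (g j) = 0
      omega
    -- Evaluate `z B adj(B)` in both orders of association.
    have hdet : ∀ i, B.det * z i = (∑ i, z i * B i 0) * B.adjugate 0 i := fun i => by
      have h1 : Matrix.vecMul (Matrix.vecMul z B) B.adjugate i = B.det * z i := by
        rw [Matrix.vecMul_vecMul, Matrix.mul_adjugate, Matrix.vecMul_smul, Matrix.vecMul_one]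
        rfl
      rw [← h1]
      change ∑ j, (∑ i, z i * B i j) * B.adjugate j i = _
      exact Finset.sum_eq_single 0 (fun j _ hj => by rw [hq j hj, zero_mul]) (by simp)
    rw [Int.mem_range_signType_cast]
    by_cases hall : ∀ i, B.adjugate 0 i = 0
    · have := hyB 0
      simp only [hall, zero_mul, Finset.sum_const_zero, Matrix.one_apply_eq, mul_one] at this
      exact Or.inr (Or.inl this.symm)
    · push Not at hall
      obtain ⟨i, hi⟩ := hall
      have h1 := hdet i
      have h0 := hz (g 0)
      change _ = -1 ∨ _ = 0 ∨ _ = 1 at h0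
      change B.det * z i = (∑ i, z i * A (f i) (g 0)) * B.adjugate 0 i at h1
      rcases hz1 i hi with e | e <;> rcases h0 with e0 | e0 | e0 <;> rcases hy i with e1 | e1 | e1 <;>
        rw [e, e0, e1] at h1 <;> omega

/-! ### Integrality of polytopes of totally unimodular systems -/

/-- A matrix over a field whose kernel is trivial has a nonsingular square submatrix that uses all
columns. -/
theorem Matrix.exists_rows_det_ne_zero {K m n : Type*} [Field K] [Finite m] [Fintype n]
    [DecidableEq n] (M : Matrix m n K) (hM : ∀ d, M.mulVec d = 0 → d = 0) :
    ∃ r : n → m, (M.submatrix r id).det ≠ 0 := by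
  have := Fintype.ofFinite m
  have hker : LinearMap.ker M.mulVecLin = ⊥ := by
    rw [LinearMap.ker_eq_bot']
    exact hM
  have hrank : Module.finrank K (Submodule.span K (Set.range M.row)) = Fintype.card n := by
    rw [← Matrix.rank_eq_finrank_span_row, Matrix.rank,
      LinearMap.finrank_range_of_inj (LinearMap.ker_eq_bot.1 hker), Module.finrank_fintype_fun_eq_card]
  obtain ⟨f, hf, -, hli⟩ := Submodule.exists_fun_fin_finrank_span_eq K (Set.range M.row)
  choose r hr using hf
  let e : n ≃ Fin (Module.finrank K (Submodule.span K (Set.range M.row))) :=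
    Fintype.equivOfCardEq (by rw [Fintype.card_fin, hrank])
  refine ⟨r ∘ e, ?_⟩
  rw [← isUnit_iff_ne_zero, ← Matrix.isUnit_iff_isUnit_det,
    ← Matrix.linearIndependent_rows_iff_isUnit]
  have hrow : (M.submatrix (r ∘ e) id).row = f ∘ e := funext fun i => hr (e i)
  rw [hrow]
  exact hli.comp e e.injective

/-- The box-constrained polytope of the system `c ≤ A x`. -/
def coverPolytope {m n : Type*} [Fintype n] (A : Matrix m n ℤ) (c : m → ℤ) : Set (n → ℝ) :=
  {x | (∀ j, 0 ≤ x j ∧ x j ≤ 1) ∧ ∀ i, (c i : ℝ) ≤ ∑ j, (A i j : ℝ) * x j}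

theorem isCompact_coverPolytope {m n : Type*} [Fintype n] (A : Matrix m n ℤ) (c : m → ℤ) :
    IsCompact (coverPolytope A c) := by
  refine (isCompact_univ_pi (fun _ : n => isCompact_Icc (a := (0 : ℝ)) (b := 1))).of_isClosed_subset
    ?_ fun x hx j _ => hx.1 j
  simp only [coverPolytope, Set.ofPred_and, Set.ofPred_forall]
  refine IsClosed.inter (isClosed_iInter fun j => IsClosed.inter ?_ ?_) (isClosed_iInter fun i => ?_)
  · exact isClosed_le continuous_const (continuous_apply j)
  · exact isClosed_le (continuous_apply j) continuous_const
  · exact isClosed_le continuous_const (by fun_prop)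

/-- Every constraint that is not tight at `x` has slack, and non-integral coordinates lie strictly
inside (0, 1). So `x + t d` stays in the polytope for small `t` of either sign, and `x` would be the
midpoint of a segment unless `d = 0`. -/
theorem eq_zero_of_mem_extremePoints_coverPolytope {m n : Type*} [Finite m] [Fintype n]
    {A : Matrix m n ℤ} {c : m → ℤ} {x : n → ℝ} (hx : x ∈ (coverPolytope A c).extremePoints ℝ)
    {d : n → ℝ} (hd : ∀ j, (∃ z : ℤ, x j = z) → d j = 0)
    (hAd : ∀ i, ∑ j, (A i j : ℝ) * x j = c i → ∑ j, (A i j : ℝ) * d j = 0) : d = 0 := by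
  rw [mem_extremePoints] at hx
  obtain ⟨hxK, hext⟩ := hx
  have hsum : ∀ (t : ℝ) i, ∑ j, (A i j : ℝ) * (x j + t * d j) =
      ∑ j, (A i j : ℝ) * x j + t * ∑ j, (A i j : ℝ) * d j := fun t i => by
    rw [Finset.mul_sum, ← Finset.sum_add_distrib]
    exact Finset.sum_congr rfl fun j _ => by ring
  have hnear : ∀ᶠ t in nhds (0 : ℝ), (fun j => x j + t * d j) ∈ coverPolytope A c := by
    refine Filter.Eventually.and (Filter.eventually_all.2 fun j => ?_)
      (Filter.eventually_all.2 fun i => ?_)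
    · by_cases hj : ∃ z : ℤ, x j = z
      · simpa [hd j hj] using hxK.1 j
      · have h0 : 0 < x j := (hxK.1 j).1.lt_of_ne fun e => hj ⟨0, by simp [← e]⟩
        have h1 : x j < 1 := (hxK.1 j).2.lt_of_ne fun e => hj ⟨1, by simp [e]⟩
        have hc : Filter.Tendsto (fun t : ℝ => x j + t * d j) (nhds 0) (nhds (x j)) := by
          have : Continuous fun t : ℝ => x j + t * d j := by fun_prop
          simpa using this.tendsto 0
        exact ((hc.eventually_const_lt h0).and (hc.eventually_lt_const h1)).mono
          fun t ht => ⟨ht.1.le, ht.2.le⟩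
    · simp only [hsum]
      by_cases hi : ∑ j, (A i j : ℝ) * x j = c i
      · simp [hAd i hi, hi]
      · have hlt : (c i : ℝ) < ∑ j, (A i j : ℝ) * x j := (hxK.2 i).lt_of_ne (Ne.symm hi)
        have hc : Filter.Tendsto (fun t : ℝ => ∑ j, (A i j : ℝ) * x j + t * ∑ j, (A i j : ℝ) * d j)
            (nhds 0) (nhds (∑ j, (A i j : ℝ) * x j)) := by
          have : Continuous fun t : ℝ =>
            ∑ j, (A i j : ℝ) * x j + t * ∑ j, (A i j : ℝ) * d j := by fun_prop
          simpa using this.tendsto 0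
        exact (hc.eventually_const_lt hlt).mono fun t ht => ht.le
  obtain ⟨ε, hε, hball⟩ := Metric.eventually_nhds_iff.1 hnear
  have hp := hball (y := ε / 2) (by rw [Real.dist_eq, sub_zero, abs_of_pos (by positivity)]; linarith)
  have hm := hball (y := -(ε / 2)) (by
    rw [Real.dist_eq, sub_zero, abs_neg, abs_of_pos (by positivity)]; linarith)
  have heq := (hext _ hp _ hm ⟨1 / 2, 1 / 2, by norm_num, by norm_num, by norm_num, by
    funext j; simp only [Pi.add_apply, Pi.smul_apply, smul_eq_mul]; ring⟩).1
  funext j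
  have := congrFun heq j
  simp only [add_eq_left, mul_eq_zero] at this
  exact this.resolve_left (by positivity)

/-- The extreme points of the polytope of a totally unimodular system are integral. -/
theorem integral_of_mem_extremePoints_coverPolytope {m n : Type*} [Finite m] [Fintype n]
    {A : Matrix m n ℤ} (hA : A.IsTotallyUnimodular) {c : m → ℤ} {x : n → ℝ}
    (hx : x ∈ (coverPolytope A c).extremePoints ℝ) (j : n) : ∃ z : ℤ, x j = z := by
  let N := {j : n // ¬ ∃ z : ℤ, x j = z}
  let T := {i : m // ∑ j, (A i j : ℝ) * x j = c i}
  have hsplit : ∀ g : n → ℝ, ∑ j, g j = ∑ j : N, g j + ∑ j : {j // ∃ z : ℤ, x j = z}, g j := fun g => by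
    rw [add_comm]
    exact (Fintype.sum_subtype_add_sum_subtype (fun j => ∃ z : ℤ, x j = z) g).symm
  let B : Matrix T N ℤ := A.submatrix Subtype.val Subtype.val
  -- The tight rows, restricted to the fractional coordinates, have trivial kernel: a kernel vector
  -- extended by zero is a direction excluded by extremality.
  obtain ⟨r, hr⟩ := (B.map (Int.cast : ℤ → ℝ)).exists_rows_det_ne_zero fun d hd => by
    let d' : n → ℝ := fun j => if h : ¬ ∃ z : ℤ, x j = z then d ⟨j, h⟩ else 0
    have h0 : d' = 0 := by
      refine eq_zero_of_mem_extremePoints_coverPolytope hx (fun j hj => dif_neg (not_not.2 hj))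
        fun i hi => ?_
      rw [hsplit, Finset.sum_eq_zero
        (s := (Finset.univ : Finset {j // ∃ z : ℤ, x j = z})) fun j _ => ?_, add_zero]
      · refine Eq.trans (Finset.sum_congr rfl fun j _ => ?_) (congrFun hd ⟨i, hi⟩)
        simp only [d', dif_pos j.2]
        rfl
      · simp only [d', dif_neg (not_not.2 j.2), mul_zero]
    funext j
    have := congrFun h0 j
    simp only [d', dif_pos j.2] at this
    exact this
  let D : Matrix N N ℤ := B.submatrix r id
  have hmap : (B.map (Int.cast : ℤ → ℝ)).submatrix r id = D.map (Int.cast : ℤ → ℝ) := rfl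
  have hdetcast : (D.map (Int.cast : ℤ → ℝ)).det = (D.det : ℝ) :=
    ((Int.castRingHom ℝ).map_det D).symm
  have hunit : IsUnit D.det := by
    have h1 : D.det ∈ Set.range SignType.cast :=
      (Matrix.isTotallyUnimodular_iff_fintype A).1 hA N (fun j => (r j).1) Subtype.val
    rw [hmap, hdetcast] at hr
    rw [Int.mem_range_signType_cast] at h1
    rw [Int.cast_ne_zero] at hr
    rw [Int.isUnit_iff]
    omega
  choose! ζ hζ using fun j : {j // ∃ z : ℤ, x j = z} => j.2
  -- With the integral coordinates moved to the right-hand side, the fractional ones solve a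
  -- unimodular system with integer data, so they are integers after all.
  let v : N → ℤ := fun i => c (r i).1 - ∑ j, A (r i).1 j.1 * ζ j
  have hDx : (D.map (Int.cast : ℤ → ℝ)).mulVec (fun j : N => x j) = fun i => (v i : ℝ) := by
    funext i
    have h := (r i).2
    rw [hsplit] at h
    simp only [v]
    push_cast
    rw [← h]
    simp only [hζ, add_sub_cancel_right]
    rfl
  by_contra hj
  refine hj ⟨(D⁻¹.mulVec v) ⟨j, hj⟩, ?_⟩
  have hinv : (D⁻¹).map (Int.cast : ℤ → ℝ) * D.map (Int.cast : ℤ → ℝ) = 1 := by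
    have h := congrArg (Int.castRingHom ℝ).mapMatrix (Matrix.nonsing_inv_mul D hunit)
    rwa [map_mul, map_one] at h
  have h2 := congrArg ((D⁻¹).map (Int.cast : ℤ → ℝ)).mulVec hDx
  rw [Matrix.mulVec_mulVec, hinv, Matrix.one_mulVec] at h2
  rw [show x j = (fun j : N => x j) ⟨j, hj⟩ from rfl, h2]
  simp [Matrix.mulVec, dotProduct]

/-- A linear functional attains its minimum over the nonempty polytope of a totally unimodular
system at an integral point. -/
theorem exists_integral_minimizer_coverPolytope {m n : Type*} [Finite m] [Fintype n]
    {A : Matrix m n ℤ} (hA : A.IsTotallyUnimodular) {c : m → ℤ}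
    (hne : (coverPolytope A c).Nonempty) (w : n → ℝ) :
    ∃ x ∈ coverPolytope A c, (∀ j, ∃ z : ℤ, x j = z) ∧
      ∀ y ∈ coverPolytope A c, ∑ j, w j * x j ≤ ∑ j, w j * y j := by
  -- The sign is reversed because `toExposed` is the face of maximizers. An extreme point of that
  -- face is extreme in the whole polytope.
  let l : StrongDual ℝ (n → ℝ) := -∑ j, w j • ContinuousLinearMap.proj j
  have hl : ∀ y, l y = -∑ j, w j * y j := fun y => by simp [l]
  have hK := isCompact_coverPolytope A c
  have hexp : IsExposed ℝ (coverPolytope A c) (l.toExposed (coverPolytope A c)) :=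
    ContinuousLinearMap.toExposed.isExposed
  obtain ⟨x₀, hx₀, hmax⟩ := hK.exists_isMaxOn hne l.continuous.continuousOn
  obtain ⟨x, hx⟩ := (hexp.isCompact hK).extremePoints_nonempty ⟨x₀, hx₀, fun y hy => hmax hy⟩
  refine ⟨x, hx.1.1, integral_of_mem_extremePoints_coverPolytope hA
    (hexp.isExtreme.extremePoints_subset_extremePoints hx), fun y hy => ?_⟩
  have := hx.1.2 y hy
  rw [hl, hl] at this
  linarith

/-! ### Equivalence of the three formulations -/

theorem IndependenceSystem.mem_sets_iff {V : Type*} [Finite V] (S : IndependenceSystem V)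
    {U : Set V} : U ∈ S.sets ↔ ∀ F ∈ S.circuits, ¬ F ⊆ U := by
  refine ⟨fun hU F hF hFU => Minimal.prop (P := fun U => U ∉ S.sets) hF
    (S.mem_of_subset U hU F hFU), fun h => ?_⟩
  by_contra hU
  obtain ⟨F, hFU, hF⟩ := exists_minimal_le_of_wellFoundedLT (fun U => U ∉ S.sets) U hU
  exact h F hF hFU

namespace DataFusionProblem

variable {V : Type*} [Fintype V] (P : DataFusionProblem V)

theorem isFeasibleSubgraph_iff {E₁ : Finset P.Edge} : P.IsFeasibleSubgraph E₁ ↔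
    ∀ C : (P.spanning E₁).ConnectedComponent, C.supp ∈ P.allowable.sets := by
  simp only [P.allowable.mem_sets_iff]
  exact ⟨fun h C F hF => h F hF C, fun h F hF C => h C F hF⟩

theorem isHypergraphColoring_iff {χ : V → ℕ} : P.IsHypergraphColoring χ ↔
    ∀ j, χ ⁻¹' {j} ∈ P.allowable.sets := by
  simp only [P.allowable.mem_sets_iff]
  exact ⟨fun h j F hF => h F hF j, fun h F hF j => h j F hF⟩

theorem spanning_adj {E₁ : Finset P.Edge} {u v : V} :
    (P.spanning E₁).Adj u v ↔ ∃ e ∈ E₁, (e : Sym2 V) = s(u, v) := by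
  rw [spanning, SimpleGraph.fromEdgeSet_adj]
  constructor
  · rintro ⟨⟨e, he, h⟩, -⟩
    exact ⟨e, he, h⟩
  · rintro ⟨e, he, h⟩
    refine ⟨⟨e, he, h⟩, ?_⟩
    have := e.2
    rw [h] at this
    exact SimpleGraph.Adj.ne this

theorem mem_edgeSet_spanning {E₁ : Finset P.Edge} {s : Sym2 V} :
    s ∈ (P.spanning E₁).edgeSet ↔ ∃ e ∈ E₁, (e : Sym2 V) = s := by
  induction s with
  | _ u v => exact P.spanning_adj

theorem spanning_le (E₁ : Finset P.Edge) : P.spanning E₁ ≤ P.graph := by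
  intro u v h
  obtain ⟨e, -, he⟩ := P.spanning_adj.1 h
  have := e.2
  rwa [he] at this

theorem reachable_of_mem {E₁ : Finset P.Edge} {e : P.Edge} (he : e ∈ E₁) {u v : V}
    (hu : u ∈ (e : Sym2 V)) (hv : v ∈ (e : Sym2 V)) : (P.spanning E₁).Reachable u v := by
  by_cases huv : u = v
  · rw [huv]
  · exact (P.spanning_adj.2 ⟨e, he, (Sym2.mem_and_mem_iff huv).1 ⟨hu, hv⟩⟩).reachable

theorem coloringCost_eq (χ : V → ℕ) : P.coloringCost χ = ∑ e, P.weight e -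
    ∑ e ∈ Finset.univ.filter fun e : P.Edge =>
      ∀ u ∈ (e : Sym2 V), ∀ v ∈ (e : Sym2 V), χ u = χ v, P.weight e := by
  rw [eq_sub_iff_add_eq, add_comm, ← Finset.sum_filter_add_sum_filter_not Finset.univ
    (fun e : P.Edge => ∀ u ∈ (e : Sym2 V), ∀ v ∈ (e : Sym2 V), χ u = χ v), coloringCost]
  push Not
  rfl

/-- The colour is constant along walks of uncut edges, so each component lies in one colour class.
-/
theorem IsHypergraphColoring.isFeasibleSubgraph {χ : V → ℕ} (hχ : P.IsHypergraphColoring χ) :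
    P.IsFeasibleSubgraph (Finset.univ.filter fun e : P.Edge =>
      ∀ u ∈ (e : Sym2 V), ∀ v ∈ (e : Sym2 V), χ u = χ v) := by
  rw [isHypergraphColoring_iff] at hχ
  rw [isFeasibleSubgraph_iff]
  intro C
  induction C using SimpleGraph.ConnectedComponent.ind with
  | _ v =>
    refine P.allowable.mem_of_subset _ (hχ (χ v)) _ fun u hu => ?_
    obtain ⟨p⟩ := SimpleGraph.ConnectedComponent.exact hu
    clear hu
    induction p with
    | nil => rfl
    | cons h _ ih =>
      obtain ⟨e, he, huv⟩ := P.spanning_adj.1 h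
      have h' := (Finset.mem_filter.1 he).2
      rw [huv] at h'
      exact (h' _ (Sym2.mem_mk_left _ _) _ (Sym2.mem_mk_right _ _)).trans ih

/-- The edges with both endpoints in a common member of `N`. -/
def matchedEdges (N : Finset (Set V)) : Finset P.Edge :=
  N.biUnion fun U => Finset.univ.filter fun e : P.Edge => ∀ v ∈ (e : Sym2 V), v ∈ U

theorem mem_matchedEdges {N : Finset (Set V)} {e : P.Edge} :
    e ∈ P.matchedEdges N ↔ ∃ U ∈ N, ∀ v ∈ (e : Sym2 V), v ∈ U := by
  simp [matchedEdges]

theorem sum_inducedWeight {N : Finset (Set V)} (hN : (N : Set (Set V)).PairwiseDisjoint id) :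
    ∑ U ∈ N, P.inducedWeight U = ∑ e ∈ P.matchedEdges N, P.weight e := by
  rw [matchedEdges, Finset.sum_biUnion]
  · rfl
  · intro U hU W hW hne
    refine Finset.disjoint_left.2 fun e heU heW => ?_
    have hv := Sym2.out_fst_mem (e : Sym2 V)
    exact Set.disjoint_left.1 (hN hU hW hne) ((Finset.mem_filter.1 heU).2 _ hv)
      ((Finset.mem_filter.1 heW).2 _ hv)

/-- Consecutive edges of a walk share a vertex, so disjointness puts them in the same member of `N`.
The case `u = v` covers vertices outside all members. -/
theorem eq_or_exists_mem_of_reachable_matchedEdges {N : Finset (Set V)}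
    (hN : (N : Set (Set V)).PairwiseDisjoint id) {u v : V}
    (h : (P.spanning (P.matchedEdges N)).Reachable u v) : u = v ∨ ∃ U ∈ N, u ∈ U ∧ v ∈ U := by
  obtain ⟨p⟩ := h
  induction p with
  | nil => exact Or.inl rfl
  | cons h _ ih =>
    obtain ⟨e, he, huv⟩ := P.spanning_adj.1 h
    obtain ⟨U, hU, hUe⟩ := P.mem_matchedEdges.1 he
    rw [huv] at hUe
    have h1 := hUe _ (Sym2.mem_mk_left _ _)
    have h2 := hUe _ (Sym2.mem_mk_right _ _)
    rcases ih with rfl | ⟨W, hW, hw, hv⟩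
    · exact Or.inr ⟨U, hU, h1, h2⟩
    · obtain rfl := hN.elim_set hU hW _ h2 hw
      exact Or.inr ⟨U, hU, h1, hv⟩

theorem IsMatching.isFeasibleSubgraph {N : Finset (Set V)} (hN : P.IsMatching N) :
    P.IsFeasibleSubgraph (P.matchedEdges N) := by
  rw [isFeasibleSubgraph_iff]
  intro C
  induction C using SimpleGraph.ConnectedComponent.ind with
  | _ v =>
    have key := fun u (hu : u ∈ (SimpleGraph.connectedComponentMk _ v).supp) =>
      P.eq_or_exists_mem_of_reachable_matchedEdges hN.2 (SimpleGraph.ConnectedComponent.exact hu)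
    by_cases hv : ∃ U ∈ N, v ∈ U
    · obtain ⟨U, hU, hvU⟩ := hv
      refine P.allowable.mem_of_subset U (hN.1 U hU) _ fun u hu => ?_
      rcases key u hu with rfl | ⟨W, hW, huW, hvW⟩
      · exact hvU
      · exact hN.2.elim_set hU hW _ hvU hvW ▸ huW
    · refine P.allowable.mem_of_subset _ (P.singleton_mem v) _ fun u hu => ?_
      rcases key u hu with rfl | ⟨W, hW, huW, hvW⟩
      · rfl
      · exact absurd ⟨W, hW, hvW⟩ hv

theorem isMatching_componentSets {E₁ : Finset P.Edge} (h : P.IsFeasibleSubgraph E₁) :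
    P.IsMatching (P.componentSets E₁) := by
  rw [isFeasibleSubgraph_iff] at h
  constructor
  · intro U hU
    obtain ⟨C, -, rfl⟩ := Finset.mem_image.1 hU
    exact h C
  · intro U hU W hW hne
    obtain ⟨C, -, rfl⟩ := Finset.mem_image.1 hU
    obtain ⟨D, -, rfl⟩ := Finset.mem_image.1 hW
    exact (P.spanning E₁).pairwise_disjoint_supp_connectedComponent fun e => hne (e ▸ rfl)

theorem subset_matchedEdges_componentSets (E₁ : Finset P.Edge) :
    E₁ ⊆ P.matchedEdges (P.componentSets E₁) := by
  intro e he
  refine P.mem_matchedEdges.2 ⟨_, Finset.mem_image.2 ⟨(P.spanning E₁).connectedComponentMk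
    (e : Sym2 V).out.1, Finset.mem_univ _, rfl⟩, fun v hv => ?_⟩
  exact SimpleGraph.ConnectedComponent.sound (P.reachable_of_mem he hv (Sym2.out_fst_mem _))

/-- A maximum subgraph solves the coloring and the matching formulation as well. -/
theorem IsMaximumSubgraph.isOptimumDeletion {K : Finset P.Edge} (hK : P.IsMaximumSubgraph Kᶜ) :
    P.IsOptimumDeletion K := by
  refine ⟨hK, fun χ hχ => ⟨?_, fun ψ hψ => ?_⟩, P.isMatching_componentSets hK.1, fun N hN => ?_⟩
  · rw [isHypergraphColoring_iff]
    intro j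
    by_cases hj : ∃ v, χ v = j
    · obtain ⟨v, rfl⟩ := hj
      refine P.allowable.mem_of_subset _
        (P.isFeasibleSubgraph_iff.1 hK.1 ((P.spanning Kᶜ).connectedComponentMk v)) _ fun u hu => ?_
      exact SimpleGraph.ConnectedComponent.sound ((hχ u v).1 hu)
    · convert P.allowable.empty_mem
      exact Set.eq_empty_of_forall_notMem fun v hv => hj ⟨v, hv⟩
  · rw [coloringCost_eq, coloringCost_eq]
    refine sub_le_sub_left ((hK.2 _ (hψ.isFeasibleSubgraph P)).trans ?_) _
    -- Kept edges are uncut by `χ`; the inclusion suffices since weights are positive.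
    refine Finset.sum_le_sum_of_subset_of_nonneg (fun e he => ?_) fun e _ _ => (P.weight_pos e).le
    exact Finset.mem_filter.2 ⟨Finset.mem_univ _, fun u hu v hv =>
      (hχ u v).2 (P.reachable_of_mem he hu hv)⟩
  · rw [P.sum_inducedWeight hN.2, P.sum_inducedWeight (P.isMatching_componentSets hK.1).2]
    exact (hK.2 _ (hN.isFeasibleSubgraph P)).trans (Finset.sum_le_sum_of_subset_of_nonneg
      (P.subset_matchedEdges_componentSets _) fun e _ _ => (P.weight_pos e).le)

/-! ### Trees and set cover -/

/-- A path in the subgraph is also a path in the tree, hence equals `p` by uniqueness. -/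
theorem reachable_spanning_iff (hT : P.graph.IsTree) {E₁ : Finset P.Edge} {u v : V}
    {p : P.graph.Walk u v} (hp : p.IsPath) :
    (P.spanning E₁).Reachable u v ↔ ∀ e : P.Edge, (e : Sym2 V) ∈ p.edges → e ∈ E₁ := by
  constructor
  · intro h e he
    obtain ⟨q, hq⟩ := h.exists_isPath
    rw [(hT.existsUnique_path u v).unique hp
      ((SimpleGraph.Walk.isPath_mapLe (P.spanning_le E₁)).2 hq),
      SimpleGraph.Walk.edges_mapLe_eq_edges] at he
    obtain ⟨e', he', h⟩ := P.mem_edgeSet_spanning.1 (q.edges_subset_edgeSet he)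
    exact Subtype.ext h ▸ he'
  · intro h
    exact ⟨p.transfer _ fun e he => P.mem_edgeSet_spanning.2
      ⟨⟨e, p.edges_subset_edgeSet he⟩, h _ he, rfl⟩⟩

theorem nonempty_of_mem_forbidden {F : Set V} (hF : F ∈ P.forbidden) : F.Nonempty :=
  Set.nonempty_iff_ne_empty.2 fun h => Minimal.prop (P := fun U => U ∉ P.allowable.sets) hF
    (h ▸ P.allowable.empty_mem)

theorem isFeasibleSubgraph_iff_of_isTree (hT : P.graph.IsTree) {E₁ : Finset P.Edge} :
    P.IsFeasibleSubgraph E₁ ↔ ∀ F ∈ P.forbidden, ∃ e ∈ P.pathEdges F, e ∉ E₁ := by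
  refine forall₂_congr fun F hF => ?_
  constructor
  · intro h
    by_contra! hall
    -- A base vertex of `F`: if all path edges are kept, all of `F` lies in its component.
    obtain ⟨v, hv⟩ := P.nonempty_of_mem_forbidden hF
    refine h ((P.spanning E₁).connectedComponentMk v) fun u hu => ?_
    obtain ⟨p, hp⟩ := (hT.existsUnique_path u v).exists
    exact SimpleGraph.ConnectedComponent.sound ((P.reachable_spanning_iff hT hp).2
      fun e he => hall e ⟨u, hu, v, hv, p, hp, he⟩)
  · rintro ⟨e, ⟨u, hu, v, hv, p, hp, he⟩, heE⟩ C hC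
    exact heE ((P.reachable_spanning_iff hT hp).1
      (SimpleGraph.ConnectedComponent.exact ((hC hu).trans (hC hv).symm)) e he)

/-! ### The linear program and its integral optima -/

theorem constraintMatrix_apply (F : P.forbidden) (e : P.Edge) :
    P.constraintMatrix F e = if e ∈ P.pathEdges (F : Set V) then 1 else 0 := rfl

theorem constraintMatrix_nonneg (F : P.forbidden) (e : P.Edge) :
    (0 : ℝ) ≤ P.constraintMatrix F e := by
  rw [constraintMatrix_apply]
  split_ifs <;> simp

theorem one_le_sum_of_mem {x : P.Edge → ℝ} (hx : ∀ e, 0 ≤ x e) {F : P.forbidden} {e : P.Edge}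
    (he : e ∈ P.pathEdges (F : Set V)) (h1 : 1 ≤ x e) :
    1 ≤ ∑ e, (P.constraintMatrix F e : ℝ) * x e := by
  refine le_trans ?_ (Finset.single_le_sum
    (fun e _ => mul_nonneg (P.constraintMatrix_nonneg F e) (hx e)) (Finset.mem_univ e))
  simpa [constraintMatrix_apply, he] using h1

/-- The matrix is 0/1: a capped coordinate in the support of a row satisfies that row alone, and a
row with no such coordinate keeps its value. -/
theorem IsLPFeasible.truncate {x : P.Edge → ℝ} (hx : P.IsLPFeasible x) :
    P.IsLPFeasible fun e => min (x e) 1 := by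
  refine ⟨fun e => le_min (hx.1 e) zero_le_one, fun F => ?_⟩
  by_cases h : ∃ e ∈ P.pathEdges (F : Set V), 1 ≤ x e
  · obtain ⟨e, he, h1⟩ := h
    exact P.one_le_sum_of_mem (fun e => le_min (hx.1 e) zero_le_one) he (le_min h1 le_rfl)
  · push Not at h
    refine (hx.2 F).trans_eq (Finset.sum_congr rfl fun e _ => ?_)
    rw [constraintMatrix_apply]
    split_ifs with he
    · exact congrArg _ (min_eq_left (h e he).le).symm
    · simp

theorem cost_mono {x y : P.Edge → ℝ} (h : ∀ e, x e ≤ y e) : P.cost x ≤ P.cost y :=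
  Finset.sum_le_sum fun e _ => mul_le_mul_of_nonneg_left (h e) (P.weight_pos e).le

/-- Otherwise capping would strictly lower the cost, as weights are positive. -/
theorem IsLPOptimum.le_one {x : P.Edge → ℝ} (hx : P.IsLPOptimum x) (e : P.Edge) : x e ≤ 1 := by
  by_contra! h
  refine (hx.2 _ (hx.1.truncate P)).not_gt (Finset.sum_lt_sum (fun e _ =>
    mul_le_mul_of_nonneg_left (min_le_left _ _) (P.weight_pos e).le) ⟨e, Finset.mem_univ e, ?_⟩)
  exact mul_lt_mul_of_pos_left (min_lt_of_right_lt h) (P.weight_pos e)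

theorem isLPFeasible_indicator (hT : P.graph.IsTree) {E₁ : Finset P.Edge}
    (h : P.IsFeasibleSubgraph E₁) : P.IsLPFeasible fun e => if e ∈ E₁ then 0 else 1 := by
  have h0 : ∀ e : P.Edge, (0 : ℝ) ≤ if e ∈ E₁ then 0 else 1 := fun e => by split_ifs <;> simp
  refine ⟨h0, fun F => ?_⟩
  obtain ⟨e, he, heE⟩ := (P.isFeasibleSubgraph_iff_of_isTree hT).1 h F F.2
  exact P.one_le_sum_of_mem h0 he (by simp [heE])

theorem mem_coverPolytope_iff {x : P.Edge → ℝ} : x ∈ coverPolytope P.constraintMatrix (fun _ => 1) ↔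
    P.IsLPFeasible x ∧ ∀ e, x e ≤ 1 := by
  simp only [coverPolytope, IsLPFeasible, SatisfiesConstraints, Set.mem_ofPred_eq, Int.cast_one,
    forall_and]
  tauto

theorem exists_isLPFeasible (hT : P.graph.IsTree) : ∃ x, P.IsLPFeasible x := by
  refine ⟨_, P.isLPFeasible_indicator hT (E₁ := ∅) (P.isFeasibleSubgraph_iff.2 fun C => ?_)⟩
  have hbot : P.spanning ∅ = ⊥ := by simp [spanning]
  induction C using SimpleGraph.ConnectedComponent.ind with
  | _ v =>
    refine P.allowable.mem_of_subset _ (P.singleton_mem v) _ fun u hu => ?_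
    have hr := SimpleGraph.ConnectedComponent.exact hu
    rw [hbot, SimpleGraph.reachable_bot] at hr
    exact hr

theorem exists_integral_isLPOptimum (hT : P.graph.IsTree)
    (hA : P.constraintMatrix.IsTotallyUnimodular) :
    ∃ x : P.Edge → ℝ, (∀ e, ∃ z : ℤ, x e = z) ∧ P.IsLPOptimum x := by
  obtain ⟨x₀, hx₀⟩ := P.exists_isLPFeasible hT
  have htrunc : ∀ y, P.IsLPFeasible y →
      (fun e => min (y e) 1) ∈ coverPolytope P.constraintMatrix (fun _ => 1) := fun y hy =>
    P.mem_coverPolytope_iff.2 ⟨hy.truncate P, fun e => min_le_right _ _⟩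
  obtain ⟨x, hx, hint, hmin⟩ :=
    exists_integral_minimizer_coverPolytope hA ⟨_, htrunc x₀ hx₀⟩ P.weight
  exact ⟨x, hint, (P.mem_coverPolytope_iff.1 hx).1, fun y hy =>
    (hmin _ (htrunc y hy)).trans (P.cost_mono fun e => min_le_left _ _)⟩

theorem IsLPOptimum.eq_zero_or_one {x : P.Edge → ℝ} (hx : P.IsLPOptimum x)
    (hint : ∀ e, ∃ z : ℤ, x e = z) (e : P.Edge) : x e = 0 ∨ x e = 1 := by
  obtain ⟨z, hz⟩ := hint e
  have h0 := hx.1.1 e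
  have h1 := hx.le_one P e
  rw [hz] at h0 h1 ⊢
  norm_cast at h0 h1 ⊢
  omega

theorem IsLPOptimum.isMaximumSubgraph (hT : P.graph.IsTree) {x : P.Edge → ℝ}
    (hx : P.IsLPOptimum x) (h01 : ∀ e, x e = 0 ∨ x e = 1) {K : Finset P.Edge}
    (hK : ∀ e, e ∈ K ↔ x e = 1) : P.IsMaximumSubgraph Kᶜ := by
  refine ⟨(P.isFeasibleSubgraph_iff_of_isTree hT).2 fun F hF => ?_, fun E₂ hE₂ => ?_⟩
  · by_contra! hall
    refine absurd (hx.1.2 ⟨F, hF⟩) (not_le.2 ?_)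
    rw [Finset.sum_eq_zero fun e _ => ?_]
    · exact zero_lt_one
    · rw [constraintMatrix_apply]
      split_ifs with he
      · have hne := fun h1 => Finset.mem_compl.1 (hall e he) ((hK e).2 h1)
        rw [(h01 e).resolve_right hne, mul_zero]
      · simp
  -- The cost of a deletion is the total weight minus the kept weight, so comparing costs with the
  -- indicator of the complement of `E₂` compares kept weights.
  · have hcost : ∀ (E₁ : Finset P.Edge) (y : P.Edge → ℝ), (∀ e, y e = if e ∈ E₁ then 0 else 1) →
        P.cost y = ∑ e, P.weight e - ∑ e ∈ E₁, P.weight e := fun E₁ y hy => by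
      have hE₁ : ∑ e ∈ E₁, P.weight e = ∑ e, if e ∈ E₁ then P.weight e else 0 := by
        rw [Finset.sum_ite_mem, Finset.univ_inter]
      rw [eq_sub_iff_add_eq, cost, hE₁, ← Finset.sum_add_distrib]
      refine Finset.sum_congr rfl fun e _ => ?_
      rw [hy]
      split_ifs <;> simp
    have h := hx.2 _ (P.isLPFeasible_indicator hT hE₂)
    rw [hcost E₂ _ fun _ => rfl, hcost Kᶜ x fun e => ?_] at h
    · linarith
    · by_cases he : e ∈ K
      · simp [he, (hK e).1 he]
      · simp [he, (h01 e).resolve_right fun h1 => he ((hK e).2 h1)]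

end DataFusionProblem

end

theorem mainTheorem10 {V : Type*} [Fintype V] (P : DataFusionProblem V)
    (hT : P.graph.IsTree) (hA : GhouilaHouri P.constraintMatrix) :
    P.constraintMatrix.IsTotallyUnimodular ∧
    (∃ x : P.Edge → ℝ, (∀ e, ∃ z : ℤ, x e = z) ∧ P.IsLPOptimum x) ∧
    (∀ x : P.Edge → ℝ, (∀ e, ∃ z : ℤ, x e = z) → P.IsLPOptimum x →
      P.IsSetCoverOptimum x ∧
      ∀ K : Finset P.Edge, (∀ e, e ∈ K ↔ x e = 1) → P.IsOptimumDeletion K) := by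
  refine ⟨hA.isTotallyUnimodular, P.exists_integral_isLPOptimum hT hA.isTotallyUnimodular,
    fun x hint hx => ?_⟩
  have h01 := hx.eq_zero_or_one P hint
  refine ⟨⟨⟨h01, hx.1.2⟩, fun y hy => hx.2 y ⟨fun e => ?_, hy.2⟩⟩, fun K hK =>
    (hx.isMaximumSubgraph P hT h01 hK).isOptimumDeletion P⟩
  rcases hy.1 e with h | h <;> simp [h]
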